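/- Let $G$ be a finite simple graph with $n$ vertices and $e$ edges, let $c = 2e/n^2$ (so that $0\le c\le 1$; put $c=0$ if $n=0$), and let $N$ be the number of 4-edge paths in $G$, that is, the number of (not necessarily induced) subgraphs of $G$ isomorphic to the path with five vertices and four edges. Then $$\tfrac12 c^4n^5\bigl(1-O(n^{-1})\bigr)\;\le\; N\;\le\;\tfrac12\max\Bigl((1-\sqrt{1-c})^2\bigl((c+1)\sqrt{1-c}+c\bigr),\;c^{5/2}\Bigr)\,n^5 .$$ The upper bound is exact (it holds for every $G$, with no error term). In the lower bound the $O$-constant depends only on the density: for every $c_0>0$ there is a constant $C=C(c_0)$ such that $N\ge\tfrac12c^4n^5(1-C/n)$ for every finite simple graph with $c\ge c_0$. Moreover, the error is $O(n^4)$ with an absolute constant: there is a constant $K$ such that $N\ge\tfrac12c^4n^5-Kn^4$ for every finite simple graph. -/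

import Mathlib

/-- The density parameter `c = 2 e / n ^ 2` of a graph with `n` vertices and `e` edges. -/
noncomputable def edgeDensityParam {V : Type*} [Fintype V] (G : SimpleGraph V) : ℝ :=
  2 * (G.edgeSet.ncard : ℝ) / (Fintype.card V : ℝ) ^ 2

/-- The number of 4-edge paths in `G`: the number of (not necessarily induced) subgraphs of `G`
isomorphic to the path with 5 vertices and 4 edges. -/
noncomputable def numFourEdgePaths {V : Type*} [Fintype V] (G : SimpleGraph V) : ℕ :=
  G.copyCount (SimpleGraph.pathGraph 5)

/-! ### The pointwise inequality in degree and neighbour-degree sum. -/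

section

open Finset

/-! Let `d v` be the degree of `v` and `s v` the sum of the degrees of its neighbours. Splitting at
the middle vertex, there are `∑ s v ^ 2` walks with four edges; up to at most `10 n ^ 4` degenerate
walks this is `2N`. Lower bound: `∑ s = ∑ d ^ 2`, so Cauchy–Schwarz twice gives `c ^ 4 * n ^ 5`.
Upper bound: after scaling, every vertex satisfies `s ≤ d`, `s ≤ c` and `2s ≤ c + d ^ 2`. For a
suitable multiplier `γ` these force `s ^ 2 - γ (s - d ^ 2) ≤ (M / c) d`, with `M` the claimed
maximum (`exists_sq_combination_le_linear`). Summed over vertices, the `γ` term vanishes and `∑ d`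
is known. -/

/-- The upper boundary of the region is `s = d` up to `d = a`, then `s = (c + d ^ 2) / 2` up to `d =
r`, then `s = c`. Convexity along each piece leaves the corners `d = a, r, 1`, which are exactly
`h_a`, `h_r`, `h_one`. The corners at `a` and `1` are the vertex types of a quasi-star; the corner
at `r` is a clique vertex of a quasi-clique. -/
lemma sq_combination_le_linear {a r c α γ d s : ℝ} (ha : 0 < a) (hac : c = a * (2 - a)) (hr : 0 < r)
    (hrc : c = r ^ 2) (har : a ≤ r) (hc : c < 1) (hγ : 0 ≤ γ) (hγα : γ ≤ α)
    (h_a : a ≤ α + γ * (1 - a)) (h_r : r ^ 3 ≤ α) (h_one : γ * (1 - c) ≤ α - c ^ 2)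
    (hd0 : 0 ≤ d) (hd1 : d ≤ 1) (hs0 : 0 ≤ s) (hsd : s ≤ d) (hsc : s ≤ c)
    (hs2 : 2 * s ≤ c + d ^ 2) :
    s ^ 2 - γ * s + γ * d ^ 2 ≤ α * d := by
  have hzero : γ * d ^ 2 ≤ α * d := by nlinarith [mul_nonneg hγ hd0, mul_le_mul_of_nonneg_right hγα hd0]
  -- convexity in `s` reduces the claim to an upper bound for `s`
  have key : ∀ t : ℝ, s ≤ t → t ^ 2 - γ * t + γ * d ^ 2 ≤ α * d →
      s ^ 2 - γ * s + γ * d ^ 2 ≤ α * d := by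
    intro t hst ht
    rcases le_or_gt s γ with h | h
    · nlinarith
    · nlinarith
  rcases le_total d a with hda | hda
  · refine key d hsd ?_
    have : d * (1 + γ) ≤ α + γ := by nlinarith
    nlinarith
  rcases le_total d r with hdr | hdr
  · refine key ((c + d ^ 2) / 2) (by linarith) ?_
    have e1 : a ^ 2 - γ * a + γ * a ^ 2 ≤ α * a := by nlinarith
    have e2 : c ^ 2 ≤ α * r := by
      rw [hrc]; nlinarith
    rcases eq_or_lt_of_le har with rfl | hlt
    · have : d = a := le_antisymm hdr hda
      subst this
      have : (c + d ^ 2) / 2 = d := by rw [hac]; ring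
      rw [this]; exact e1
    have ea : (c + a ^ 2) / 2 = a := by rw [hac]; ring
    have er : (c + r ^ 2) / 2 = c := by rw [← hrc]; ring
    have h1 : ((c + a ^ 2) / 2) ^ 2 - γ * ((c + a ^ 2) / 2) + γ * a ^ 2 - α * a ≤ 0 := by
      rw [ea]; linarith
    have h2 : ((c + r ^ 2) / 2) ^ 2 - γ * ((c + r ^ 2) / 2) + γ * r ^ 2 - α * r ≤ 0 := by
      rw [er, ← hrc]; linarith
    -- Convexity on `[a, r]` in explicit form: the chord through the endpoints minus a nonnegative
    -- remainder.
    have hconv : (r - a) * (((c + d ^ 2) / 2) ^ 2 - γ * ((c + d ^ 2) / 2) + γ * d ^ 2 - α * d) =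
        (r - d) * (((c + a ^ 2) / 2) ^ 2 - γ * ((c + a ^ 2) / 2) + γ * a ^ 2 - α * a) +
        (d - a) * (((c + r ^ 2) / 2) ^ 2 - γ * ((c + r ^ 2) / 2) + γ * r ^ 2 - α * r) -
        (r - d) * (d - a) * (r - a) *
          ((a ^ 2 + d ^ 2 + r ^ 2 + a * d + a * r + d * r) / 4 + c / 2 + γ / 2) := by ring
    have hc0 : 0 ≤ c := by rw [hrc]; positivity
    have hp : 0 ≤ (r - d) * (d - a) * (r - a) *
          ((a ^ 2 + d ^ 2 + r ^ 2 + a * d + a * r + d * r) / 4 + c / 2 + γ / 2) := by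
      have := sub_nonneg.2 hdr
      have := sub_nonneg.2 hda
      have := sub_nonneg.2 har
      positivity
    have := mul_nonpos_of_nonneg_of_nonpos (sub_nonneg.2 hdr) h1
    have := mul_nonpos_of_nonneg_of_nonpos (sub_nonneg.2 hda) h2
    have : (r - a) * (((c + d ^ 2) / 2) ^ 2 - γ * ((c + d ^ 2) / 2) + γ * d ^ 2 - α * d) ≤ 0 := by
      rw [hconv]; linarith
    have := nonpos_of_mul_nonpos_right this (sub_pos.2 hlt)
    linarith
  · refine key c hsc ?_
    have e2 : c ^ 2 ≤ α * r := by
      rw [hrc]; nlinarith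
    have hr1 : r < 1 := by nlinarith
    have hconv : (1 - r) * (c ^ 2 - γ * c + γ * d ^ 2 - α * d) =
        (1 - d) * (c ^ 2 - γ * c + γ * r ^ 2 - α * r) +
        (d - r) * (c ^ 2 - γ * c + γ - α) - (1 - d) * (d - r) * (1 - r) * γ := by ring
    have h1 : c ^ 2 - γ * c + γ * r ^ 2 - α * r ≤ 0 := by rw [← hrc]; linarith
    have h2 : c ^ 2 - γ * c + γ - α ≤ 0 := by linarith
    have := mul_nonpos_of_nonneg_of_nonpos (sub_nonneg.2 hd1) h1
    have := mul_nonpos_of_nonneg_of_nonpos (sub_nonneg.2 hdr) h2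
    have : 0 ≤ (1 - d) * (d - r) * (1 - r) * γ := by
      have := sub_nonneg.2 hdr
      have := sub_nonneg.2 hd1
      have := sub_nonneg.2 hr1.le
      positivity
    have : (1 - r) * (c ^ 2 - γ * c + γ * d ^ 2 - α * d) ≤ 0 := by rw [hconv]; linarith
    have := nonpos_of_mul_nonpos_right this (sub_pos.2 hr1)
    linarith

/-- The asymptotic density of homomorphisms of the 4-edge path into the quasi-star or the
quasi-clique of edge density `c`, whichever is larger. -/
noncomputable def quasiStarCliqueBound (c : ℝ) : ℝ :=
  max ((1 - √(1 - c)) ^ 2 * ((c + 1) * √(1 - c) + c)) (c ^ (5 / 2 : ℝ))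

lemma quasiStarCliqueBound_nonneg {c : ℝ} (hc : 0 ≤ c) : 0 ≤ quasiStarCliqueBound c :=
  le_max_of_le_right (Real.rpow_nonneg hc _)

lemma rpow_five_halves {c : ℝ} (hc : 0 ≤ c) : c ^ (5 / 2 : ℝ) = √c ^ 5 := by
  rw [Real.sqrt_eq_rpow, ← Real.rpow_natCast, ← Real.rpow_mul hc]
  norm_num

lemma exists_sq_combination_le_linear {c : ℝ} (hc0 : 0 < c) (hc1 : c < 1) :
    ∃ γ : ℝ, ∀ d s : ℝ, 0 ≤ d → d ≤ 1 → 0 ≤ s → s ≤ d → s ≤ c → 2 * s ≤ c + d ^ 2 →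
      s ^ 2 - γ * s + γ * d ^ 2 ≤ quasiStarCliqueBound c / c * d := by
  obtain ⟨a, ha⟩ : ∃ a, a = 1 - √(1 - c) := ⟨_, rfl⟩
  obtain ⟨r, hr⟩ : ∃ r, r = √c := ⟨_, rfl⟩
  have hrc : c = r ^ 2 := by rw [hr, Real.sq_sqrt hc0.le]
  have hr0 : 0 < r := hr ▸ Real.sqrt_pos.2 hc0
  have hr1 : r < 1 := by nlinarith
  have hb : √(1 - c) = 1 - a := by rw [ha]; ring
  have hac : c = a * (2 - a) := by
    have : √(1 - c) ^ 2 = 1 - c := Real.sq_sqrt (by linarith)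
    rw [hb] at this; linarith
  have ha1 : a < 1 := by
    have : 0 < √(1 - c) := Real.sqrt_pos.2 (by linarith)
    linarith
  have ha0 : 0 < a := by
    by_contra! h
    nlinarith
  have hca : a ≤ c := by rw [hac]; nlinarith
  have hcr : c ≤ r := by rw [hrc]; nlinarith
  obtain ⟨M, hM⟩ : ∃ M, M = quasiStarCliqueBound c := ⟨_, rfl⟩
  have hT : (1 - √(1 - c)) ^ 2 * ((c + 1) * √(1 - c) + c) = a * c ^ 2 + (1 - a) * a ^ 2 := by
    rw [hb, hac]; ring
  have hMT : a * c ^ 2 + (1 - a) * a ^ 2 ≤ M := by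
    rw [hM, ← hT]; exact le_max_left _ _
  have hMr : r ^ 5 ≤ M := by
    rw [hM, hr, ← rpow_five_halves hc0.le]; exact le_max_right _ _
  have hMc : M ≤ c ^ 2 := by
    rw [hM, quasiStarCliqueBound, hT, rpow_five_halves hc0.le, ← hr]
    refine max_le ?_ ?_
    · have : a ^ 2 ≤ c ^ 2 := by gcongr
      nlinarith
    · rw [hrc]
      nlinarith [pow_pos hr0 4]
  rw [← hM]
  obtain ⟨α, hα⟩ : ∃ α, α = M / c := ⟨_, rfl⟩
  have hαc : α * c = M := by rw [hα]; field_simp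
  rw [← hα]
  have hαr : r ^ 3 ≤ α := by
    rw [hα, le_div_iff₀ hc0, hrc]; linarith [hMr, show r ^ 3 * r ^ 2 = r ^ 5 by ring]
  have hα_le : α ≤ c := by
    rw [hα, div_le_iff₀ hc0]; linarith
  have hcα : c ^ 2 ≤ α := by
    refine le_trans ?_ hαr
    rw [hrc]; nlinarith [pow_pos hr0 3]
  have h1c : 0 < 1 - c := by linarith
  -- This `γ` makes the corner `d = 1` tight; the corner `d = a` then amounts to `M` being at least
  -- the quasi-star value.
  obtain ⟨γ, hγ⟩ : ∃ γ, γ = (α - c ^ 2) / (1 - c) := ⟨_, rfl⟩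
  have hγc : γ * (1 - c) = α - c ^ 2 := by rw [hγ]; field_simp
  refine ⟨γ, fun d s hd0 hd1 hs0 hsd hsc hs2 =>
    sq_combination_le_linear ha0 hac hr0 hrc (hca.trans hcr) hc1 ?_ ?_ ?_ hαr hγc.le
      hd0 hd1 hs0 hsd hsc hs2⟩
  · rw [hγ]; exact div_nonneg (by linarith) h1c.le
  · rw [hγ, div_le_iff₀ h1c]; nlinarith
  · have h1 : 1 - c = (1 - a) ^ 2 := by rw [hac]; ring
    have h2 : γ * (1 - a) ^ 2 = α - c ^ 2 := by rw [← h1, hγc]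
    have h3 : a * (1 - a) + c ^ 2 ≤ α * (2 - a) := by
      have : a * (a * (1 - a) + c ^ 2) ≤ a * (α * (2 - a)) := by
        have : a * (α * (2 - a)) = M := by rw [← hαc, hac]; ring
        rw [this]; linarith
      exact le_of_mul_le_mul_left this ha0
    have h4 : a * (1 - a) ≤ (α + γ * (1 - a)) * (1 - a) := by
      linarith [show (α + γ * (1 - a)) * (1 - a) = α * (1 - a) + γ * (1 - a) ^ 2 by ring]
    exact le_of_mul_le_mul_right h4 (by linarith)

/-! ### Bounds on `∑ s ^ 2` for symmetric matrices. -/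

section Weighted

variable {V : Type*} [Fintype V] {A : V → V → ℝ}

/-- Symmetrising over `u, w` reduces this to `z (x + y) ≤ z + x y` on `[0, 1]`, that is, `z (1 - x)
(1 - y) + (1 - z) x y ≥ 0`. -/
lemma two_mul_sum_mul_rowSum_le (hsymm : ∀ u v, A u v = A v u) (h0 : ∀ u v, 0 ≤ A u v)
    (h1 : ∀ u v, A u v ≤ 1) (v : V) :
    2 * ∑ u, A v u * ∑ w, A u w ≤ ∑ u, ∑ w, A u w + (∑ u, A v u) ^ 2 := by
  have e1 : ∑ u, A v u * ∑ w, A u w = ∑ u, ∑ w, A v u * A u w := by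
    simp_rw [mul_sum]
  have e2 : ∑ u, A v u * ∑ w, A u w = ∑ u, ∑ w, A v w * A u w := by
    rw [e1, sum_comm]
    exact sum_congr rfl fun u _ => sum_congr rfl fun w _ => by rw [hsymm u w]
  rw [two_mul, sq, sum_mul_sum]
  nth_rw 1 [e1]
  rw [e2, ← sum_add_distrib, ← sum_add_distrib]
  refine sum_le_sum fun u _ => ?_
  rw [← sum_add_distrib, ← sum_add_distrib]
  refine sum_le_sum fun w _ => ?_
  nlinarith [mul_nonneg (h0 v u) (h0 v w), h0 u w, h1 u w,
    mul_nonneg (h0 u w) (mul_nonneg (sub_nonneg.2 (h1 v u)) (sub_nonneg.2 (h1 v w))),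
    mul_nonneg (sub_nonneg.2 (h1 u w)) (mul_nonneg (h0 v u) (h0 v w))]

lemma sum_sum_mul_rowSum (hsymm : ∀ u v, A u v = A v u) :
    ∑ v, ∑ u, A v u * ∑ w, A u w = ∑ v, (∑ u, A v u) ^ 2 := by
  rw [sum_comm]
  refine sum_congr rfl fun u _ => ?_
  rw [← sum_mul, sq]
  congr 1
  exact sum_congr rfl fun v _ => hsymm v u

theorem sum_sq_sum_mul_rowSum_le (hsymm : ∀ u v, A u v = A v u) (h0 : ∀ u v, 0 ≤ A u v)
    (h1 : ∀ u v, A u v ≤ 1) {c : ℝ} (hc : ∑ u, ∑ w, A u w = c * (Fintype.card V : ℝ) ^ 2) :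
    ∑ v, (∑ u, A v u * ∑ w, A u w) ^ 2 ≤ quasiStarCliqueBound c * (Fintype.card V : ℝ) ^ 5 := by
  rcases isEmpty_or_nonempty V with hV | hV
  · simp
  obtain ⟨n, hn⟩ : ∃ n : ℝ, n = Fintype.card V := ⟨_, rfl⟩
  have hn0 : 0 < n := by rw [hn]; exact_mod_cast Fintype.card_pos
  rw [← hn] at hc ⊢
  have hm0 : 0 ≤ ∑ u, ∑ w, A u w := sum_nonneg fun u _ => sum_nonneg fun w _ => h0 u w
  have hd0 : ∀ v, 0 ≤ ∑ w, A v w := fun v => sum_nonneg fun w _ => h0 v w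
  have hdn : ∀ v, ∑ w, A v w ≤ n := fun v => by
    calc ∑ w, A v w ≤ ∑ _w : V, (1 : ℝ) := sum_le_sum fun w _ => h1 v w
      _ = n := by simp [hn]
  have hmn : ∑ u, ∑ w, A u w ≤ n ^ 2 := by
    calc ∑ u, ∑ w, A u w ≤ ∑ _u : V, n := sum_le_sum fun u _ => hdn u
      _ = n ^ 2 := by simp [hn, sq]
  have hs0 : ∀ v, 0 ≤ ∑ u, A v u * ∑ w, A u w :=
    fun v => sum_nonneg fun u _ => mul_nonneg (h0 v u) (hd0 u)
  have hsm : ∀ v, ∑ u, A v u * ∑ w, A u w ≤ c * n ^ 2 := fun v => by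
    rw [← hc]
    exact sum_le_sum fun u _ => mul_le_of_le_one_left (hd0 u) (h1 v u)
  have hsd : ∀ v, ∑ u, A v u * ∑ w, A u w ≤ (∑ u, A v u) * n := fun v => by
    rw [sum_mul]
    exact sum_le_sum fun u _ => mul_le_mul_of_nonneg_left (hdn u) (h0 v u)
  have hs2 := two_mul_sum_mul_rowSum_le hsymm h0 h1
  have hsum := sum_sum_mul_rowSum hsymm
  rw [hc] at hs2 hm0 hmn
  have hn2 : 0 < n ^ 2 := by positivity
  have hc0 : 0 ≤ c := nonneg_of_mul_nonneg_left hm0 hn2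
  have hc1 : c ≤ 1 := by
    by_contra! h
    nlinarith
  have htriv : ∑ v, (∑ u, A v u * ∑ w, A u w) ^ 2 ≤ c ^ 2 * n ^ 5 := by
    calc ∑ v, (∑ u, A v u * ∑ w, A u w) ^ 2 ≤ ∑ _v : V, (c * n ^ 2) ^ 2 :=
          sum_le_sum fun v _ => pow_le_pow_left₀ (hs0 v) (hsm v) 2
      _ = c ^ 2 * n ^ 5 := by
          rw [sum_const, card_univ, nsmul_eq_mul, ← hn]; ring
  -- The multipliers have denominators `c` and `1 - c`, so the extreme densities are handled by the
  -- trivial bound `s ≤ c n ^ 2`.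
  rcases eq_or_lt_of_le hc0 with rfl | hc0
  · refine htriv.trans ?_
    have := mul_nonneg (quasiStarCliqueBound_nonneg le_rfl) (pow_pos hn0 5).le
    simpa using this
  rcases eq_or_lt_of_le hc1 with rfl | hc1
  · refine htriv.trans ?_
    simp [quasiStarCliqueBound]
  obtain ⟨γ, hγ⟩ := exists_sq_combination_le_linear hc0 hc1
  have hpt : ∀ v, (∑ u, A v u * ∑ w, A u w) ^ 2 ≤
      quasiStarCliqueBound c / c * n ^ 3 * (∑ u, A v u) +
        γ * n ^ 2 * (∑ u, A v u * ∑ w, A u w - (∑ u, A v u) ^ 2) := fun v => by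
    have h := hγ ((∑ u, A v u) / n) ((∑ u, A v u * ∑ w, A u w) / n ^ 2)
      (div_nonneg (hd0 v) hn0.le) ((div_le_one hn0).2 (hdn v)) (div_nonneg (hs0 v) hn2.le)
      (by rw [div_le_div_iff₀ hn2 hn0]; nlinarith [hsd v]) ((div_le_iff₀ hn2).2 (hsm v))
      (by
        rw [← mul_div_assoc, div_le_iff₀ hn2]
        refine (hs2 v).trans_eq ?_
        field_simp)
    generalize quasiStarCliqueBound c / c = α at h ⊢
    generalize ∑ u, A v u * ∑ w, A u w = S at h ⊢
    generalize ∑ u, A v u = D at h ⊢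
    have h' := mul_le_mul_of_nonneg_right h (pow_pos hn0 4).le
    have e1 : ((S / n ^ 2) ^ 2 - γ * (S / n ^ 2) + γ * (D / n) ^ 2) * n ^ 4 =
      S ^ 2 - γ * n ^ 2 * S + γ * n ^ 2 * D ^ 2 := by field_simp
    have e2 : α * (D / n) * n ^ 4 = α * n ^ 3 * D := by field_simp
    rw [e1, e2] at h'
    linarith
  calc ∑ v, (∑ u, A v u * ∑ w, A u w) ^ 2
      ≤ ∑ v, (quasiStarCliqueBound c / c * n ^ 3 * (∑ u, A v u) +
        γ * n ^ 2 * (∑ u, A v u * ∑ w, A u w - (∑ u, A v u) ^ 2)) := sum_le_sum fun v _ => hpt v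
    _ = quasiStarCliqueBound c * n ^ 5 := by
        rw [sum_add_distrib, ← mul_sum, ← mul_sum, sum_sub_distrib, hsum, hc]
        field_simp
        ring

theorem pow_four_le_sum_sq_sum_mul_rowSum (hsymm : ∀ u v, A u v = A v u) {c : ℝ}
    (hc : ∑ u, ∑ w, A u w = c * (Fintype.card V : ℝ) ^ 2) :
    c ^ 4 * (Fintype.card V : ℝ) ^ 5 ≤ ∑ v, (∑ u, A v u * ∑ w, A u w) ^ 2 := by
  rcases isEmpty_or_nonempty V with hV | hV
  · simp
  obtain ⟨n, hn⟩ : ∃ n : ℝ, n = Fintype.card V := ⟨_, rfl⟩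
  have hn0 : 0 < n := by rw [hn]; exact_mod_cast Fintype.card_pos
  have c1 := sq_sum_le_card_mul_sum_sq (s := (univ : Finset V)) (f := fun v => ∑ u, A v u)
  have c2 := sq_sum_le_card_mul_sum_sq (s := (univ : Finset V))
    (f := fun v => ∑ u, A v u * ∑ w, A u w)
  rw [card_univ, ← hn] at c1 c2
  rw [sum_sum_mul_rowSum hsymm] at c2
  rw [← hn] at hc ⊢
  rw [hc] at c1
  have h1 : c ^ 2 * n ^ 3 ≤ ∑ v, (∑ u, A v u) ^ 2 := by
    refine le_of_mul_le_mul_left ?_ hn0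
    linarith [show (c * n ^ 2) ^ 2 = n * (c ^ 2 * n ^ 3) by ring]
  have h2 := pow_le_pow_left₀ (by positivity) h1 2
  refine le_of_mul_le_mul_left ?_ hn0
  linarith [show (c ^ 2 * n ^ 3) ^ 2 = n * (c ^ 4 * n ^ 5) by ring]

end Weighted

/-! ### From unlabelled to labelled copies. -/

namespace SimpleGraph

lemma Copy.toSubgraph_comp_iso {V W : Type*} {G : SimpleGraph V} {H : SimpleGraph W}
    (f : Copy H G) (σ : H ≃g H) : (f.comp σ.toCopy).toSubgraph = f.toSubgraph := by
  refine Subgraph.ext ?_ ?_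
  · ext v
    constructor
    · rintro ⟨w, -, rfl⟩
      exact ⟨σ w, trivial, rfl⟩
    · rintro ⟨w, -, rfl⟩
      exact ⟨σ.symm w, trivial, congrArg f (σ.apply_symm_apply w)⟩
  · ext u v
    constructor
    · rintro ⟨a, b, hab, rfl, rfl⟩
      exact ⟨σ a, σ b, σ.map_adj_iff.2 hab, rfl, rfl⟩
    · rintro ⟨a, b, hab, rfl, rfl⟩
      exact ⟨σ.symm a, σ.symm b, σ.symm.map_adj_iff.2 hab, congrArg f (σ.apply_symm_apply a),
        congrArg f (σ.apply_symm_apply b)⟩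

lemma Copy.toSubgraph_adj_apply {V W : Type*} {G : SimpleGraph V} {H : SimpleGraph W}
    (f : Copy H G) (a b : W) : f.toSubgraph.Adj (f a) (f b) ↔ H.Adj a b := by
  constructor
  · rintro ⟨a', b', hab, ha, hb⟩
    rwa [f.injective ha, f.injective hb] at hab
  · exact fun h => ⟨a, b, h, rfl, rfl⟩

lemma Copy.mem_verts_toSubgraph {V W : Type*} {G : SimpleGraph V} {H : SimpleGraph W}
    (f : Copy H G) (v : V) : v ∈ f.toSubgraph.verts ↔ ∃ a, f a = v :=
  ⟨fun ⟨a, _, ha⟩ => ⟨a, ha⟩, fun ⟨a, ha⟩ => ⟨a, trivial, ha⟩⟩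

lemma Copy.exists_eq_comp_iso {V W : Type*} {G : SimpleGraph V} {H : SimpleGraph W}
    {f g : Copy H G} (h : g.toSubgraph = f.toSubgraph) : ∃ σ : H ≃g H, f.comp σ.toCopy = g := by
  have hfg : ∀ a, ∃ b, f b = g a := fun a => by
    rw [← f.mem_verts_toSubgraph, ← h, g.mem_verts_toSubgraph]
    exact ⟨a, rfl⟩
  have hgf : ∀ b, ∃ a, g a = f b := fun b => by
    rw [← g.mem_verts_toSubgraph, h, f.mem_verts_toSubgraph]
    exact ⟨b, rfl⟩
  choose σ hσ using hfg
  choose τ hτ using hgf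
  refine ⟨⟨⟨σ, τ, fun a => g.injective ?_, fun b => f.injective ?_⟩, ?_⟩, ?_⟩
  · exact (hτ _).trans (hσ a)
  · exact (hσ _).trans (hτ b)
  · intro a b
    change H.Adj (σ a) (σ b) ↔ H.Adj a b
    rw [← f.toSubgraph_adj_apply, ← g.toSubgraph_adj_apply, hσ, hσ, h]
  · exact Copy.ext hσ

/-- Automorphisms of `H` act simply transitively on the labelled copies with a given image subgraph.
-/
theorem labelledCopyCount_eq_copyCount_mul_card_iso {V W : Type*} [Fintype V] [Fintype W]
    (G : SimpleGraph V) (H : SimpleGraph W) :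
    G.labelledCopyCount H = G.copyCount H * Nat.card (H ≃g H) := by
  classical
  rw [copyCount_eq_card_image_copyToSubgraph, labelledCopyCount, ← card_univ,
    card_eq_sum_card_image Copy.toSubgraph, ← smul_eq_mul]
  refine sum_eq_card_nsmul fun G' hG' => ?_
  obtain ⟨f, -, rfl⟩ := mem_image.1 hG'
  rw [← Fintype.card_subtype, ← Nat.card_eq_fintype_card]
  refine (Nat.card_congr (Equiv.ofBijective
    (fun σ : H ≃g H => ⟨f.comp σ.toCopy, f.toSubgraph_comp_iso σ⟩) ⟨fun σ τ h => ?_, ?_⟩)).symm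
  · exact RelIso.ext fun a => f.injective (DFunLike.congr_fun (Subtype.ext_iff.1 h) a)
  · rintro ⟨g, hg⟩
    obtain ⟨σ, rfl⟩ := Copy.exists_eq_comp_iso hg
    exact ⟨σ, rfl⟩

theorem card_iso_pathGraph_five : Nat.card (pathGraph 5 ≃g pathGraph 5) = 2 := by
  let ρ : pathGraph 5 ≃g pathGraph 5 :=
    ⟨Fin.revPerm, by intro a b; simp only [pathGraph_adj, Fin.revPerm_apply, Fin.val_rev]; omega⟩
  have hρ : ∀ a, ρ a = Fin.rev a := fun _ => rfl
  rw [Nat.card_eq_two_iff]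
  refine ⟨RelIso.refl _, ρ, ?_, ?_⟩
  · intro h
    have := DFunLike.congr_fun h 0
    rw [hρ] at this
    simp at this
  refine Set.eq_univ_of_forall fun σ => ?_
  have hadj : ∀ a b : Fin 5, a.val + 1 = b.val →
      (σ a).val + 1 = (σ b).val ∨ (σ b).val + 1 = (σ a).val := fun a b hab => by
    rw [← pathGraph_adj, σ.map_adj_iff, pathGraph_adj]; exact Or.inl hab
  have hne : ∀ a b : Fin 5, a ≠ b → (σ a).val ≠ (σ b).val := fun a b hab h =>
    hab (σ.injective (Fin.ext h))
  -- The images move by unit steps and never turn back, so the direction of the first step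
  -- determines `σ`.
  have h01 := hadj 0 1 rfl
  have h12 := hadj 1 2 rfl
  have h23 := hadj 2 3 rfl
  have h34 := hadj 3 4 rfl
  have n02 := hne 0 2 (by decide)
  have n13 := hne 1 3 (by decide)
  have n24 := hne 2 4 (by decide)
  have b0 := (σ 0).isLt
  have b4 := (σ 4).isLt
  rcases h01 with h01 | h01
  · have e0 : (σ 0).val = 0 := by omega
    have e1 : (σ 1).val = 1 := by omega
    have e2 : (σ 2).val = 2 := by omega
    have e3 : (σ 3).val = 3 := by omega
    have e4 : (σ 4).val = 4 := by omega
    left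
    refine RelIso.ext fun a => Fin.ext ?_
    change (σ a).val = a.val
    fin_cases a
    exacts [e0, e1, e2, e3, e4]
  · have e0 : (σ 0).val = 4 := by omega
    have e1 : (σ 1).val = 3 := by omega
    have e2 : (σ 2).val = 2 := by omega
    have e3 : (σ 3).val = 1 := by omega
    have e4 : (σ 4).val = 0 := by omega
    right
    refine RelIso.ext fun a => Fin.ext ?_
    rw [hρ]
    fin_cases a
    exacts [e0, e1, e2, e3, e4]

lemma labelledCopyCount_eq_natCard {V W : Type*} [Fintype V] [Fintype W]
    (G : SimpleGraph V) (H : SimpleGraph W) : G.labelledCopyCount H = Nat.card (Copy H G) := by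
  unfold labelledCopyCount
  exact (@Nat.card_eq_fintype_card _ (_)).symm

open Classical in
lemma labelledCopyCount_pathGraph_five {V : Type*} [Fintype V] (G : SimpleGraph V) :
    G.labelledCopyCount (pathGraph 5) =
      #{f : Fin 5 → V | (∀ i : Fin 4, G.Adj (f i.castSucc) (f i.succ)) ∧ Function.Injective f} := by
  have h : #{f : Fin 5 → V | (∀ i : Fin 4, G.Adj (f i.castSucc) (f i.succ)) ∧
      Function.Injective f} = Nat.card {f : Fin 5 → V //
        (∀ i : Fin 4, G.Adj (f i.castSucc) (f i.succ)) ∧ Function.Injective f} :=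
    (Nat.subtype_card _ fun f => by simp only [mem_filter, mem_univ, true_and]).symm
  rw [h, labelledCopyCount_eq_natCard]
  have hadj : ∀ f : Fin 5 → V, (∀ i : Fin 4, G.Adj (f i.castSucc) (f i.succ)) →
      ∀ {a b}, (pathGraph 5).Adj a b → G.Adj (f a) (f b) := by
    intro f hf
    have key : ∀ a b : Fin 5, a.val + 1 = b.val → G.Adj (f a) (f b) := fun a b hab => by
      have hb : b = Fin.succ (⟨a, by omega⟩ : Fin 4) := Fin.ext hab.symm
      rw [hb]
      exact hf ⟨a, by omega⟩
    intro a b hab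
    rw [pathGraph_adj] at hab
    rcases hab with hab | hab
    · exact key a b hab
    · exact (key b a hab).symm
  have hpath : ∀ i : Fin 4, (pathGraph 5).Adj i.castSucc i.succ := fun i => by
    simp [pathGraph_adj]
  exact Nat.card_congr
    { toFun := fun f => ⟨⇑f, fun i => f.toHom.map_adj (hpath i), f.injective⟩
      invFun := fun f => ⟨⟨f.1, hadj f.1 f.2.1⟩, f.2.2⟩
      left_inv := fun f => rfl
      right_inv := fun f => rfl }

end SimpleGraph

lemma Fintype.sum_fin_succ_arrow {V : Type*} [Fintype V] {M : Type*} [AddCommMonoid M] {n : ℕ}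
    (F : (Fin (n + 1) → V) → M) :
    ∑ f, F f = ∑ x, ∑ f : Fin n → V, F (Matrix.vecCons x f) := by
  rw [← Fintype.sum_prod_type', ← (Fin.consEquiv fun _ : Fin (n + 1) => V).sum_comp]
  rfl

lemma card_not_injective_fin_five_le (V : Type*) [Fintype V] [DecidableEq V] :
    (#{f : Fin 5 → V | ¬ Function.Injective f} : ℝ) ≤ 10 * (Fintype.card V : ℝ) ^ 4 := by
  have h1 : #{f : Fin 5 → V | Function.Injective f} = (Fintype.card V).descFactorial 5 := by
    rw [← Fintype.card_subtype, Fintype.card_congr (Equiv.subtypeInjectiveEquivEmbedding _ _),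
      Fintype.card_embedding_eq, Fintype.card_fin]
  have h2 := card_filter_add_card_filter_not (s := (univ : Finset (Fin 5 → V)))
    (fun f => Function.Injective f)
  rw [h1, card_univ, Fintype.card_fun, Fintype.card_fin] at h2
  have h3 : (#{f : Fin 5 → V | ¬ Function.Injective f} : ℝ) =
      (Fintype.card V : ℝ) ^ 5 - ((Fintype.card V).descFactorial 5 : ℝ) := by
    rw [eq_sub_iff_add_eq']; exact_mod_cast h2
  rw [h3]
  generalize Fintype.card V = n
  rcases lt_or_ge n 5 with h | h
  · interval_cases n <;> norm_num [Nat.descFactorial]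
  · obtain ⟨m, rfl⟩ := Nat.exists_eq_add_of_le' h
    simp only [Nat.descFactorial]
    push_cast [show m + 5 - 4 = m + 1 by omega, show m + 5 - 3 = m + 2 by omega,
      show m + 5 - 2 = m + 3 by omega, show m + 5 - 1 = m + 4 by omega]
    have : (0 : ℝ) ≤ m := m.cast_nonneg
    -- The constant 10 is the number of pairs of positions that can coincide. With `n = m + 5` the
    -- difference has only nonnegative coefficients in `m`.
    rw [sub_le_iff_le_add, ← sub_nonneg]
    ring_nf
    positivity

/-! ### Walk counts and edge density via the adjacency indicator. -/

namespace SimpleGraph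

variable {V : Type*} (G : SimpleGraph V)

open Classical in
/-- The real-valued indicator of adjacency. -/
noncomputable def adjIndicator (u v : V) : ℝ := if G.Adj u v then 1 else 0

lemma adjIndicator_comm (u v : V) : G.adjIndicator u v = G.adjIndicator v u := by
  classical
  unfold adjIndicator
  exact if_congr (G.adj_comm u v) rfl rfl

lemma adjIndicator_nonneg (u v : V) : 0 ≤ G.adjIndicator u v := by
  unfold adjIndicator; split_ifs <;> norm_num

lemma adjIndicator_le_one (u v : V) : G.adjIndicator u v ≤ 1 := by
  unfold adjIndicator; split_ifs <;> norm_num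

variable [Fintype V]

open Classical in
lemma card_fourEdgeWalks :
    (#{f : Fin 5 → V | ∀ i : Fin 4, G.Adj (f i.castSucc) (f i.succ)} : ℝ) =
      ∑ v, (∑ u, G.adjIndicator v u * ∑ w, G.adjIndicator u w) ^ 2 := by
  have h1 : (#{f : Fin 5 → V | ∀ i : Fin 4, G.Adj (f i.castSucc) (f i.succ)} : ℝ) =
      ∑ f : Fin 5 → V, G.adjIndicator (f 0) (f 1) * G.adjIndicator (f 1) (f 2) *
        G.adjIndicator (f 2) (f 3) * G.adjIndicator (f 3) (f 4) := by
    rw [card_filter]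
    push_cast
    refine sum_congr rfl fun f _ => ?_
    simp only [adjIndicator, ← ite_and, mul_ite, mul_one, mul_zero, Fin.forall_fin_succ]
    simp
    refine if_congr ?_ rfl rfl
    tauto
  rw [h1]
  simp only [Fintype.sum_fin_succ_arrow, Fintype.sum_unique]
  simp
  have h2 : ∀ x y z : V, ∑ u, ∑ w, G.adjIndicator x y * G.adjIndicator y z * G.adjIndicator z u *
      G.adjIndicator u w = G.adjIndicator z y * G.adjIndicator y x *
        ∑ u, G.adjIndicator z u * ∑ w, G.adjIndicator u w := fun x y z => by
    simp_rw [mul_sum]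
    refine sum_congr rfl fun u _ => sum_congr rfl fun w _ => ?_
    rw [G.adjIndicator_comm x y, G.adjIndicator_comm y z]
    ring
  simp_rw [h2]
  rw [sum_comm, sum_congr rfl fun y _ => sum_comm, sum_comm]
  refine sum_congr rfl fun z _ => ?_
  simp_rw [← sum_mul, sq, ← mul_sum]

lemma sum_adjIndicator :
    ∑ u, ∑ w, G.adjIndicator u w = edgeDensityParam G * (Fintype.card V : ℝ) ^ 2 := by
  classical
  have h := G.sum_degrees_eq_twice_card_edges
  have h1 : ∑ u, ∑ w, G.adjIndicator u w = 2 * (G.edgeSet.ncard : ℝ) := by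
    rw [← coe_edgeFinset, Set.ncard_coe_finset]
    have : ∀ u, ∑ w, G.adjIndicator u w = (G.degree u : ℝ) := fun u => by
      simp [adjIndicator, ← card_neighborFinset_eq_degree, neighborFinset_eq_filter]
    simp_rw [this]
    exact_mod_cast h
  rw [h1, edgeDensityParam]
  rcases isEmpty_or_nonempty V with hV | hV
  · simp [Set.eq_empty_of_isEmpty G.edgeSet]
  · have : (Fintype.card V : ℝ) ≠ 0 := by exact_mod_cast Fintype.card_ne_zero
    field_simp

lemma edgeDensityParam_nonneg : 0 ≤ edgeDensityParam G := by
  unfold edgeDensityParam; positivity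

lemma edgeDensityParam_le_one : edgeDensityParam G ≤ 1 := by
  rcases isEmpty_or_nonempty V with hV | hV
  · simp [edgeDensityParam]
  have hn : (0 : ℝ) < (Fintype.card V : ℝ) ^ 2 := by
    have : 0 < Fintype.card V := Fintype.card_pos
    positivity
  refine le_of_mul_le_mul_right ?_ hn
  rw [← G.sum_adjIndicator, one_mul]
  calc ∑ u, ∑ w, G.adjIndicator u w ≤ ∑ _u : V, ∑ _w : V, (1 : ℝ) :=
        sum_le_sum fun u _ => sum_le_sum fun w _ => G.adjIndicator_le_one u w
    _ = (Fintype.card V : ℝ) ^ 2 := by simp [sq]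

lemma two_mul_numFourEdgePaths :
    2 * numFourEdgePaths G = G.labelledCopyCount (pathGraph 5) := by
  rw [labelledCopyCount_eq_copyCount_mul_card_iso, card_iso_pathGraph_five, numFourEdgePaths,
    mul_comm]

lemma two_mul_numFourEdgePaths_le :
    2 * (numFourEdgePaths G : ℝ) ≤
      ∑ v, (∑ u, G.adjIndicator v u * ∑ w, G.adjIndicator u w) ^ 2 := by
  classical
  rw [← card_fourEdgeWalks]
  have := G.two_mul_numFourEdgePaths
  rw [labelledCopyCount_pathGraph_five] at this
  have h : 2 * numFourEdgePaths G ≤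
      #{f : Fin 5 → V | ∀ i : Fin 4, G.Adj (f i.castSucc) (f i.succ)} := by
    rw [this]
    exact card_le_card fun f hf => by
      simp only [mem_filter, mem_univ, true_and] at hf ⊢
      exact hf.1
  exact_mod_cast h

lemma le_two_mul_numFourEdgePaths :
    ∑ v, (∑ u, G.adjIndicator v u * ∑ w, G.adjIndicator u w) ^ 2 - 10 * (Fintype.card V : ℝ) ^ 4 ≤
      2 * (numFourEdgePaths G : ℝ) := by
  classical
  rw [← card_fourEdgeWalks, sub_le_iff_le_add]
  have := G.two_mul_numFourEdgePaths
  rw [labelledCopyCount_pathGraph_five] at this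
  have h : #{f : Fin 5 → V | ∀ i : Fin 4, G.Adj (f i.castSucc) (f i.succ)} ≤
      2 * numFourEdgePaths G + #{f : Fin 5 → V | ¬ Function.Injective f} := by
    rw [this]
    refine (card_le_card fun f hf => ?_).trans (card_union_le _ _)
    simp only [mem_filter, mem_univ, true_and, mem_union] at hf ⊢
    tauto
  have h' : (#{f : Fin 5 → V | ∀ i : Fin 4, G.Adj (f i.castSucc) (f i.succ)} : ℝ) ≤
      2 * (numFourEdgePaths G : ℝ) + (#{f : Fin 5 → V | ¬ Function.Injective f} : ℝ) := by
    exact_mod_cast h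
  linarith [card_not_injective_fin_five_le V]

lemma half_pow_four_mul_sub_le_numFourEdgePaths :
    1 / 2 * edgeDensityParam G ^ 4 * (Fintype.card V : ℝ) ^ 5 - 5 * (Fintype.card V : ℝ) ^ 4 ≤
      (numFourEdgePaths G : ℝ) := by
  have h1 := pow_four_le_sum_sq_sum_mul_rowSum G.adjIndicator_comm G.sum_adjIndicator
  have h2 := G.le_two_mul_numFourEdgePaths
  linarith

end SimpleGraph

end

theorem theorem1 :
    -- the parameter `c` lies in `[0, 1]`
    (∀ (V : Type*) [Fintype V] (G : SimpleGraph V),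
      0 ≤ edgeDensityParam G ∧ edgeDensityParam G ≤ 1) ∧
    -- lower bound with relative error `O(1/n)`, the constant depending only on the density
    (∀ c₀ : ℝ, 0 < c₀ → ∃ C : ℝ, ∀ (V : Type*) [Fintype V] (G : SimpleGraph V),
      c₀ ≤ edgeDensityParam G →
        1 / 2 * edgeDensityParam G ^ 4 * (Fintype.card V : ℝ) ^ 5 * (1 - C / (Fintype.card V : ℝ))
          ≤ (numFourEdgePaths G : ℝ)) ∧
    -- lower bound with additive error `O(n ^ 4)`, the constant being absolute
    (∃ K : ℝ, ∀ (V : Type*) [Fintype V] (G : SimpleGraph V),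
      1 / 2 * edgeDensityParam G ^ 4 * (Fintype.card V : ℝ) ^ 5 - K * (Fintype.card V : ℝ) ^ 4
        ≤ (numFourEdgePaths G : ℝ)) ∧
    -- upper bound
    (∀ (V : Type*) [Fintype V] (G : SimpleGraph V),
      (numFourEdgePaths G : ℝ) ≤
        1 / 2 *
          max ((1 - √(1 - edgeDensityParam G)) ^ 2 *
                ((edgeDensityParam G + 1) * √(1 - edgeDensityParam G) + edgeDensityParam G))
              (edgeDensityParam G ^ (5 / 2 : ℝ)) *
          (Fintype.card V : ℝ) ^ 5) := by
  refine ⟨fun V _ G => ⟨G.edgeDensityParam_nonneg, G.edgeDensityParam_le_one⟩,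
    -- The error `5 n ^ 4` relative to `c ^ 4 * n ^ 5 / 2` is `10 / (c ^ 4 * n)`, and `c ≥ c₀`.
    fun c₀ hc₀ => ⟨10 / c₀ ^ 4, fun V _ G hG => ?_⟩,
    ⟨5, fun V _ G => G.half_pow_four_mul_sub_le_numFourEdgePaths⟩, fun V _ G => ?_⟩
  · refine le_trans ?_ G.half_pow_four_mul_sub_le_numFourEdgePaths
    have hc : 0 < edgeDensityParam G := hc₀.trans_le hG
    have hn : (Fintype.card V : ℝ) ≠ 0 := by
      intro h
      simp [edgeDensityParam, h] at hc
    have h1 : 10 ≤ 10 / c₀ ^ 4 * edgeDensityParam G ^ 4 := by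
      rw [div_mul_eq_mul_div, le_div_iff₀ (by positivity)]
      gcongr
    have h2 : 1 / 2 * edgeDensityParam G ^ 4 * (Fintype.card V : ℝ) ^ 5 *
        (1 - 10 / c₀ ^ 4 / (Fintype.card V : ℝ)) =
        1 / 2 * edgeDensityParam G ^ 4 * (Fintype.card V : ℝ) ^ 5 -
          1 / 2 * (10 / c₀ ^ 4 * edgeDensityParam G ^ 4) * (Fintype.card V : ℝ) ^ 4 := by
      field_simp
    rw [h2]
    nlinarith [mul_le_mul_of_nonneg_right h1 (by positivity : (0 : ℝ) ≤ (Fintype.card V : ℝ) ^ 4)]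
  · have h1 := G.two_mul_numFourEdgePaths_le
    have h2 := sum_sq_sum_mul_rowSum_le G.adjIndicator_comm G.adjIndicator_nonneg
      G.adjIndicator_le_one G.sum_adjIndicator
    rw [quasiStarCliqueBound] at h2
    linarith
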